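/- Let $T_1(x)=\frac13x$ and $T_2(x)=\frac13x+\frac23$ on $\mathbb R$, and let $P$ be the Cantor distribution, i.e. the unique Borel probability measure on $\mathbb R$ with $P=\frac12P\circ T_1^{-1}+\frac12P\circ T_2^{-1}$. For $x\in\mathbb R$ and $(a,b)\in\mathbb R^2$ put $\rho(x,(a,b))=(x-a)^2+b^2$, the squared Euclidean distance between $(x,0)$ and $(a,b)$, and for a finite nonempty set $\alpha\subset\mathbb R^2$ put $V(P;\alpha)=\int\min_{a\in\alpha}\rho(x,a)\,dP(x)$. For $j\in\mathbb N=\{1,2,\dots\}$ let $S_j=\{(x,\frac1j):0\le x\le1\}$, and for $n\in\mathbb N$ let $$V_n=\inf\Big\{V(P;\alpha):\ \alpha\subseteq\bigcup_{j=1}^nS_j,\ 1\le\operatorname{card}(\alpha)\le n\Big\}.$$ A set $\alpha\subseteq\bigcup_{j=1}^nS_j$ with $1\le\operatorname{card}(\alpha)\le n$ and $V(P;\alpha)=V_n$ is called an optimal set of $n$-points. For a finite word $\sigma=\sigma_1\cdots\sigma_k$ over $\{1,2\}$ let $T_\sigma=T_{\sigma_1}\circ\cdots\circ T_{\sigma_k}$,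 $J_\sigma=T_\sigma([0,1])$ and $a(\sigma)=\frac1{P(J_\sigma)}\int_{J_\sigma}x\,dP(x)$. **Theorem.** Let $n\ge2$, and let $\ell(n)$ be the unique natural number with $2^{\ell(n)}\le n<2^{\ell(n)+1}$. For every set $I\subseteq\{1,2\}^{\ell(n)}$ with $\operatorname{card}(I)=n-2^{\ell(n)}$, the set $$\alpha_n(I)=\{(a(\sigma),\tfrac1n):\sigma\in\{1,2\}^{\ell(n)}\setminus I\}\cup\{(a(\sigma1),\tfrac1n):\sigma\in I\}\cup\{(a(\sigma2),\tfrac1n):\sigma\in I\}$$ is contained in $S_n$ and is an optimal set of $n$-points, and the $n$-th constrained quantization error is $$V_n=V(P;\alpha_n(I))=\frac1{18^{\ell(n)}}\cdot\frac18\Big(2^{\ell(n)+1}-n+\frac19\big(n-2^{\ell(n)}\big)\Big)+\frac1{n^2}.$$ -/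

import Mathlib

open MeasureTheory Set
open scoped ENNReal

namespace CantorQuantization

/-! ### The Cantor distribution -/

/-- The two generating similarities of the Cantor set, `x ↦ x / 3` and `x ↦ x / 3 + 2 / 3`.
The two letters `1`, `2` of the alphabet are represented by `0`, `1 : Fin 2`. -/
noncomputable def T (i : Fin 2) (x : ℝ) : ℝ := if i = 0 then x / 3 else x / 3 + 2 / 3

/-- `P` is a Borel probability measure on `ℝ` with `P = ½ P ∘ T₁⁻¹ + ½ P ∘ T₂⁻¹`. -/
def IsCantorDistribution (P : Measure ℝ) : Prop :=
  IsProbabilityMeasure P ∧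
    P = (2⁻¹ : ℝ≥0∞) • P.map (T 0) + (2⁻¹ : ℝ≥0∞) • P.map (T 1)

theorem continuous_T (i : Fin 2) : Continuous (T i) := by
  unfold T
  split_ifs <;> fun_prop

theorem charFun_eq_of_isCantorDistribution {P : Measure ℝ} (hP : IsCantorDistribution P) (t : ℝ) :
    charFun P t = ((1 + Complex.exp ((t * (2 / 3) : ℝ) * Complex.I)) / 2) * charFun P (t / 3) := by
  obtain ⟨hp, h⟩ := hP
  have hint : ∀ (μ : Measure ℝ) [IsFiniteMeasure μ],
      Integrable (fun x : ℝ => Complex.exp (t * x * Complex.I)) μ := by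
    intro μ _
    refine Integrable.of_bound (C := 1) (by fun_prop) (Filter.Eventually.of_forall fun x => ?_)
    have := Complex.norm_exp_ofReal_mul_I (t * x)
    push_cast at this
    exact this.le
  have h0 : IsProbabilityMeasure (P.map (T 0)) :=
    Measure.isProbabilityMeasure_map (continuous_T 0).aemeasurable
  have h1 : IsProbabilityMeasure (P.map (T 1)) :=
    Measure.isProbabilityMeasure_map (continuous_T 1).aemeasurable
  conv_lhs => rw [h]
  rw [charFun_apply_real, integral_add_measure ((hint _).smul_measure (by simp))
    ((hint _).smul_measure (by simp)), integral_smul_measure, integral_smul_measure,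
    integral_map (continuous_T 0).aemeasurable (by fun_prop),
    integral_map (continuous_T 1).aemeasurable (by fun_prop), charFun_apply_real]
  have e0 : ∀ x : ℝ, Complex.exp (t * (T 0 x : ℝ) * Complex.I)
      = Complex.exp ((t / 3 : ℝ) * x * Complex.I) := by
    intro x
    have : T 0 x = x / 3 := by simp [T]
    rw [this]; congr 1; push_cast; ring
  have e1 : ∀ x : ℝ, Complex.exp (t * (T 1 x : ℝ) * Complex.I)
      = Complex.exp ((t * (2 / 3) : ℝ) * Complex.I) *
        Complex.exp ((t / 3 : ℝ) * x * Complex.I) := by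
    intro x
    have : T 1 x = x / 3 + 2 / 3 := by simp [T]
    rw [← Complex.exp_add, this]; congr 1; push_cast; ring
  simp only [e0, e1]
  rw [integral_const_mul]
  simp only [ENNReal.toReal_inv, ENNReal.toReal_ofNat, Complex.real_smul]
  push_cast
  ring

theorem IsCantorDistribution.unique {P Q : Measure ℝ} (hP : IsCantorDistribution P)
    (hQ : IsCantorDistribution Q) : P = Q := by
  have := hP.1
  have := hQ.1
  refine Measure.ext_of_charFun ?_
  funext t
  have step : ∀ s : ℝ, ‖charFun P s - charFun Q s‖ ≤ ‖charFun P (s / 3) - charFun Q (s / 3)‖ := by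
    intro s
    rw [charFun_eq_of_isCantorDistribution hP s, charFun_eq_of_isCantorDistribution hQ s,
      ← mul_sub, norm_mul]
    refine mul_le_of_le_one_left (norm_nonneg _) ?_
    rw [norm_div]
    have h1 := norm_add_le (1 : ℂ) (Complex.exp ((s * (2 / 3) : ℝ) * Complex.I))
    rw [Complex.norm_exp_ofReal_mul_I] at h1
    simp only [norm_one, Complex.norm_ofNat] at h1 ⊢
    linarith
  have iter : ∀ n : ℕ, ‖charFun P t - charFun Q t‖ ≤
      ‖charFun P (t / 3 ^ n) - charFun Q (t / 3 ^ n)‖ := by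
    intro n
    induction n with
    | zero => simp
    | succ n ih =>
      refine ih.trans ((step _).trans_eq ?_)
      rw [pow_succ, div_div]
  have hlim : Filter.Tendsto (fun n : ℕ => t / (3 : ℝ) ^ n) Filter.atTop (nhds 0) :=
    tendsto_const_nhds.div_atTop (tendsto_pow_atTop_atTop_of_one_lt (by norm_num))
  have hc : Continuous fun s : ℝ => ‖charFun P s - charFun Q s‖ := by fun_prop
  have hl := (hc.tendsto 0).comp hlim
  simp only [charFun_zero, probReal_univ, sub_self, norm_zero] at hl
  have := ge_of_tendsto' hl iter
  exact sub_eq_zero.1 (norm_le_zero_iff.1 this)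

theorem exists_isCantorDistribution : ∃ P : Measure ℝ, IsCantorDistribution P := by
  let c : Measure (Fin 3) := (2⁻¹ : ℝ≥0∞) • Measure.dirac 0 + (2⁻¹ : ℝ≥0∞) • Measure.dirac 2
  have hc : IsProbabilityMeasure c := ⟨by simp [c, ENNReal.inv_two_add_inv_two]⟩
  let μ : Measure (ℕ → Fin 3) := Measure.infinitePi fun _ : ℕ => c
  let cons : Fin 3 → (ℕ → Fin 3) → (ℕ → Fin 3) := fun a w k => Nat.casesOn k a w
  have hcons : ∀ a, Measurable (cons a) := by
    intro a
    refine measurable_pi_lambda _ fun k => ?_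
    cases k with
    | zero => exact measurable_const
    | succ k => exact measurable_pi_apply k
  have key : (2⁻¹ : ℝ≥0∞) • μ.map (cons 0) + (2⁻¹ : ℝ≥0∞) • μ.map (cons 2) = μ := by
    refine Measure.eq_infinitePi _ fun s t ht => ?_
    have hpi : MeasurableSet (Set.pi (s : Set ℕ) t) :=
      MeasurableSet.pi s.countable_toSet fun i _ => ht i
    have hval : ∀ a, μ.map (cons a) (Set.pi (s : Set ℕ) t) =
        (if 0 ∈ s then (t 0).indicator 1 a else 1) *
          ∏ i ∈ s.erase 0, c (t i) := by
      intro a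
      rw [Measure.map_apply (hcons a) hpi]
      have hp : ∏ i ∈ s.erase 0, c (t i) =
          ∏ i ∈ (s.erase 0).preimage (· + 1) (add_left_injective 1).injOn, c (t (i + 1)) := by
        refine (Finset.prod_preimage (· + 1) (s.erase 0) (add_left_injective 1).injOn
          (fun i => c (t i)) fun x hx hx' => ?_).symm
        exact absurd ⟨x - 1, Nat.succ_pred_eq_of_ne_zero (Finset.ne_of_mem_erase hx)⟩ hx'
      have hset : cons a ⁻¹' (Set.pi (s : Set ℕ) t) =
          {_w | 0 ∈ s → a ∈ t 0} ∩
          Set.pi ((s.erase 0).preimage (· + 1) (add_left_injective 1).injOn : Finset ℕ)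
            fun i => t (i + 1) := by
        ext w
        simp only [Set.mem_preimage, Set.mem_pi, Finset.mem_coe, Set.mem_inter_iff,
          Set.mem_ofPred_eq, Finset.mem_preimage, Finset.mem_erase]
        constructor
        · intro h
          exact ⟨fun h0 => h 0 h0, fun i hi => h (i + 1) hi.2⟩
        · rintro ⟨h0, h⟩ i hi
          cases i with
          | zero => exact h0 hi
          | succ i => exact h i ⟨by simp, hi⟩
      rw [hset, hp, ← Measure.infinitePi_pi (fun _ : ℕ => c) (fun i _ => ht (i + 1))]
      by_cases h0 : 0 ∈ s <;> by_cases ha : a ∈ t 0 <;> simp [h0, ha, μ]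
    rw [Measure.add_apply, Measure.smul_apply, Measure.smul_apply, hval, hval]
    by_cases h0 : 0 ∈ s
    · rw [← Finset.mul_prod_erase s _ h0]
      simp only [h0, if_true, smul_eq_mul]
      have : c (t 0) = 2⁻¹ * (t 0).indicator 1 0 + 2⁻¹ * (t 0).indicator 1 2 := by
        simp [c]
      rw [this]
      ring
    · simp only [h0, if_false, one_mul, smul_eq_mul, Finset.erase_eq_of_notMem h0]
      rw [← add_mul, ENNReal.inv_two_add_inv_two, one_mul]
  have hm : Measurable (Real.ofDigits : (ℕ → Fin 3) → ℝ) := Real.continuous_ofDigits.measurable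
  have hod : ∀ a w, Real.ofDigits (cons a w) = (a : ℕ) / 3 + Real.ofDigits w / 3 := by
    intro a w
    rw [Real.ofDigits_eq_sum_add_ofDigits (cons a w) 1]
    simp [Real.ofDigitsTerm, cons]
    ring
  have hmap : ∀ (a : Fin 3) (i : Fin 2), (∀ x : ℝ, T i x = (a : ℕ) / 3 + x / 3) →
      (μ.map (cons a)).map Real.ofDigits = (μ.map Real.ofDigits).map (T i) := by
    intro a i hi
    rw [Measure.map_map hm (hcons a), Measure.map_map (continuous_T i).measurable hm]
    congr 1
    funext w
    simp [hod, hi]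
  refine ⟨μ.map Real.ofDigits, Measure.isProbabilityMeasure_map hm.aemeasurable, ?_⟩
  conv_lhs => rw [← key]
  rw [Measure.map_add _ _ hm, Measure.map_smul, Measure.map_smul,
    hmap 0 0 (by intro x; simp [T]), hmap 2 1 (by intro x; simp [T]; ring)]

/-- The Cantor distribution: the unique Borel probability measure on `ℝ` with
`P = ½ P ∘ T₁⁻¹ + ½ P ∘ T₂⁻¹`. -/
noncomputable def cantorDistribution : Measure ℝ := exists_isCantorDistribution.choose

theorem isCantorDistribution_iff {P : Measure ℝ} :
    IsCantorDistribution P ↔ P = cantorDistribution :=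
  ⟨fun h => h.unique exists_isCantorDistribution.choose_spec,
    fun h => h ▸ exists_isCantorDistribution.choose_spec⟩

/-! ### Constrained quantization of order two -/

/-- The squared Euclidean distance between `x ∈ ℝ`, identified with `(x, 0)`, and a point of the
plane. -/
def ρ (x : ℝ) (p : ℝ × ℝ) : ℝ := (x - p.1) ^ 2 + p.2 ^ 2

theorem ρ_eq_dist_sq (x : ℝ) (p : ℝ × ℝ) : ρ x p = dist !₂[x, 0] !₂[p.1, p.2] ^ 2 := by
  rw [EuclideanSpace.dist_eq, Real.sq_sqrt (by positivity)]
  simp [ρ, Real.dist_eq, sq_abs]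

/-- The distortion error `∫ min_{a ∈ α} ρ(x, a) dP(x)` of a finite nonempty set `α`. -/
noncomputable def distortion (P : Measure ℝ) (α : Finset (ℝ × ℝ)) : ℝ :=
  ∫ x, ⨅ a : α, ρ x a ∂P

/-- `α ⊆ S₁ ∪ ⋯ ∪ Sₙ` and `1 ≤ card α ≤ n`. -/
def IsAdmissible (S : ℕ → Set (ℝ × ℝ)) (n : ℕ) (α : Finset (ℝ × ℝ)) : Prop :=
  (α : Set (ℝ × ℝ)) ⊆ ⋃ j ∈ Icc 1 n, S j ∧ 1 ≤ α.card ∧ α.card ≤ n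

/-- The `n`-th constrained quantization error (of order two) for `P` with respect to the
constraints `S₁, S₂, …`. -/
noncomputable def constrainedError (S : ℕ → Set (ℝ × ℝ)) (P : Measure ℝ) (n : ℕ) : ℝ :=
  sInf {v | ∃ α : Finset (ℝ × ℝ), IsAdmissible S n α ∧ v = distortion P α}

/-- `α` is an optimal set of `n`-points: an admissible set at which the infimum defining the
`n`-th constrained quantization error is attained. -/
def IsOptimalSet (S : ℕ → Set (ℝ × ℝ)) (P : Measure ℝ) (n : ℕ) (α : Finset (ℝ × ℝ)) : Prop :=
  IsAdmissible S n α ∧ distortion P α = constrainedError S P n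

/-- The constraints `S_j = {(x, 1 / j) : 0 ≤ x ≤ 1}`; only the indices `j ≥ 1` are used. -/
def segment (j : ℕ) : Set (ℝ × ℝ) := {p | (0 ≤ p.1 ∧ p.1 ≤ 1) ∧ p.2 = 1 / (j : ℝ)}

/-! ### Words, basic intervals and the sets `α_n(I)` -/

/-- `T_σ = T_{σ₁} ∘ ⋯ ∘ T_{σ_k}`. -/
noncomputable def wordMap : List (Fin 2) → ℝ → ℝ
  | [] => id
  | i :: σ => T i ∘ wordMap σ

/-- The basic interval `J_σ = T_σ([0, 1])`. -/
noncomputable def basicInterval (σ : List (Fin 2)) : Set ℝ := wordMap σ '' Icc 0 1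

/-- `a(σ) = E(X : X ∈ J_σ) = P(J_σ)⁻¹ ∫_{J_σ} x dP` for the Cantor distribution `P`. -/
noncomputable def center (σ : List (Fin 2)) : ℝ :=
  (cantorDistribution.real (basicInterval σ))⁻¹ * ∫ x in basicInterval σ, x ∂cantorDistribution

open Classical in
/-- `α_n(I)`, for a set `I` of words of length `l`: the points `(a(σ), 1/n)` with `σ ∉ I` of
length `l`, together with `(a(σ1), 1/n)` and `(a(σ2), 1/n)` for `σ ∈ I`. -/
noncomputable def alphaSet (n l : ℕ) (I : Finset (List.Vector (Fin 2) l)) : Finset (ℝ × ℝ) :=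
  (Finset.univ \ I).image (fun σ => (center σ.toList, 1 / (n : ℝ))) ∪
    I.image (fun σ => (center (σ.toList ++ [0]), 1 / (n : ℝ))) ∪
    I.image (fun σ => (center (σ.toList ++ [1]), 1 / (n : ℝ)))

end CantorQuantization

namespace CantorQuantization

/-! Every admissible point has height at least `1/n`, so replacing it by its first coordinate bounds
the constrained distortion below by `1/n²` plus the distortion on the line of at most `n` reals. The
points of `α_n(I)` all have height exactly `1/n`. What remains is the classical unconstrained
problem for the Cantor distribution.

As a function of `n`, the claimed optimum on the line is piecewise affine with breaks at powers of
two, and convex. Hence it suffices to prove the affine lower bounds `affineBound k n` for all `k`;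
the one with `k = ℓ(n) + 1` is sharp at `n`. Affine bounds suit induction on `k`: self-similarity
gives `18 D(α) = D(zoomLeft α) + D(zoomRight α)` (`lineDistortion_self_similar`), and
`affineBound_succ_add` is the same relation for every splitting `n = p + q`, so no optimization over
splittings is needed.

The induction step (`IsLowerBoundAt.succ`) distributes the points between the two halves. This is
immediate unless exactly one point lies in the open middle third and may serve both halves;
`affineBound_le_of_one_middle` treats that case, where only a few small configurations need explicit
estimates.

For the upper bound, each cell `J_σ` is served by its own centre or by the centres of its two
children, and the distortions of the cells are added up (`distortion_alphaSet_le`). -/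

theorem isCantorDistribution_cantorDistribution : IsCantorDistribution cantorDistribution :=
  isCantorDistribution_iff.2 rfl

instance : IsProbabilityMeasure cantorDistribution := isCantorDistribution_cantorDistribution.1

/-! ### Symmetry, support and moments of the Cantor distribution -/

theorem T_zero (x : ℝ) : T 0 x = x / 3 := by simp [T]

theorem T_one (x : ℝ) : T 1 x = x / 3 + 2 / 3 := by simp [T]

theorem cantorDistribution_apply {s : Set ℝ} (hs : MeasurableSet s) :
    cantorDistribution s = 2⁻¹ * cantorDistribution (T 0 ⁻¹' s) +
      2⁻¹ * cantorDistribution (T 1 ⁻¹' s) := by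
  conv_lhs => rw [isCantorDistribution_cantorDistribution.2]
  simp [Measure.map_apply (continuous_T _).measurable hs]

/-- The Cantor distribution is invariant under the reflection `x ↦ 1 - x`. -/
theorem map_one_sub_cantorDistribution :
    cantorDistribution.map (fun x => 1 - x) = cantorDistribution := by
  have hm : Measurable fun x : ℝ => 1 - x := by fun_prop
  refine isCantorDistribution_iff.1 ⟨Measure.isProbabilityMeasure_map hm.aemeasurable, ?_⟩
  have h0 : T 0 ∘ (fun x : ℝ => 1 - x) = (fun x => 1 - x) ∘ T 1 := by
    funext x; simp only [Function.comp, T_zero, T_one]; ring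
  have h1 : T 1 ∘ (fun x : ℝ => 1 - x) = (fun x => 1 - x) ∘ T 0 := by
    funext x; simp only [Function.comp, T_zero, T_one]; ring
  conv_lhs => rw [isCantorDistribution_cantorDistribution.2]
  rw [Measure.map_add _ _ hm, Measure.map_smul, Measure.map_smul,
    Measure.map_map hm (continuous_T _).measurable, Measure.map_map hm (continuous_T _).measurable,
    Measure.map_map (continuous_T _).measurable hm, Measure.map_map (continuous_T _).measurable hm,
    h0, h1, add_comm]

/-- Both preimages `T i ⁻¹' Ioi (1 + s)` lie in `Ioi (1 + 3 * s)`. Iterating, the mass beyond `1 +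
s` is at most the mass beyond `1 + 3 ^ n * s`, which tends to zero. -/
theorem cantorDistribution_Ioi_one : cantorDistribution (Ioi 1) = 0 := by
  have step : ∀ s : ℝ, 0 < s →
      cantorDistribution (Ioi (1 + s)) ≤ cantorDistribution (Ioi (1 + 3 * s)) := by
    intro s hs
    rw [cantorDistribution_apply measurableSet_Ioi]
    have h : ∀ i, cantorDistribution (T i ⁻¹' Ioi (1 + s)) ≤
        cantorDistribution (Ioi (1 + 3 * s)) := by
      intro i
      refine measure_mono fun x hx => ?_
      simp only [mem_preimage, mem_Ioi, T] at hx ⊢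
      split_ifs at hx <;> linarith
    calc _ ≤ 2⁻¹ * cantorDistribution (Ioi (1 + 3 * s)) +
          2⁻¹ * cantorDistribution (Ioi (1 + 3 * s)) := by
            gcongr 2⁻¹ * ?_ + 2⁻¹ * ?_
            exacts [h 0, h 1]
      _ = _ := by rw [← add_mul, ENNReal.inv_two_add_inv_two, one_mul]
  have zero : ∀ s : ℝ, 0 < s → cantorDistribution (Ioi (1 + s)) = 0 := by
    intro s hs
    have iter : ∀ n : ℕ, cantorDistribution (Ioi (1 + s)) ≤
        cantorDistribution (Ioi (1 + 3 ^ n * s)) := by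
      intro n
      induction n with
      | zero => simp
      | succ n ih =>
        refine ih.trans ((step _ (by positivity)).trans_eq ?_)
        rw [pow_succ]; ring_nf
    have hlim : Filter.Tendsto (fun n : ℕ => 1 + (3 : ℝ) ^ n * s) Filter.atTop Filter.atTop :=
      Filter.tendsto_atTop_add_const_left _ _
        ((tendsto_pow_atTop_atTop_of_one_lt (by norm_num)).atTop_mul_const hs)
    have h0 : Filter.Tendsto (fun t : ℝ => cantorDistribution (Ioi t)) Filter.atTop (nhds 0) := by
      have := tendsto_measure_iInter_atTop (μ := cantorDistribution) (s := fun t : ℝ => Ioi t)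
        (fun _ => measurableSet_Ioi.nullMeasurableSet) (fun _ _ h => Ioi_subset_Ioi h)
        ⟨0, measure_ne_top _ _⟩
      have he : ⋂ t : ℝ, Ioi t = ∅ := by
        ext x; simp only [mem_iInter, mem_Ioi, mem_empty_iff_false, iff_false, not_forall]
        exact ⟨x, lt_irrefl x⟩
      rwa [he, measure_empty] at this
    exact le_antisymm (ge_of_tendsto' (h0.comp hlim) iter) bot_le
  have hu : Ioi (1 : ℝ) = ⋃ n : ℕ, Ioi (1 + 1 / ((n : ℝ) + 1)) := by
    ext x
    simp only [mem_Ioi, mem_iUnion]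
    constructor
    · intro hx
      obtain ⟨n, hn⟩ := exists_nat_one_div_lt (sub_pos.2 hx)
      exact ⟨n, by linarith⟩
    · rintro ⟨n, hn⟩
      have : 0 < 1 / ((n : ℝ) + 1) := by positivity
      linarith
  rw [hu, measure_iUnion_null_iff]
  exact fun n => zero _ (by positivity)

theorem ae_mem_Icc_cantorDistribution : ∀ᵐ x ∂cantorDistribution, x ∈ Icc (0 : ℝ) 1 := by
  have h0 : cantorDistribution (Iio 0) = 0 := by
    rw [← map_one_sub_cantorDistribution, Measure.map_apply (by fun_prop) measurableSet_Iio]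
    convert cantorDistribution_Ioi_one using 2
    ext x; simp
  refine measure_mono_null (fun x hx => ?_) (measure_union_null h0 cantorDistribution_Ioi_one)
  by_contra h
  simp only [mem_union, mem_Iio, mem_Ioi, not_or, not_lt] at h
  exact hx h

theorem integrable_cantorDistribution {F : ℝ → ℝ} (hF : Continuous F) :
    Integrable F cantorDistribution := by
  rw [← Measure.restrict_eq_self_of_ae_mem ae_mem_Icc_cantorDistribution]
  exact hF.continuousOn.integrableOn_compact isCompact_Icc

theorem integral_cantorDistribution_mono {F G : ℝ → ℝ} (hF : Continuous F) (hG : Continuous G)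
    (h : ∀ x, 0 ≤ x → x ≤ 1 → F x ≤ G x) :
    ∫ x, F x ∂cantorDistribution ≤ ∫ x, G x ∂cantorDistribution := by
  refine integral_mono_ae (integrable_cantorDistribution hF) (integrable_cantorDistribution hG) ?_
  filter_upwards [ae_mem_Icc_cantorDistribution] with x hx using h x hx.1 hx.2

theorem integral_cantorDistribution_eq {F : ℝ → ℝ} (hF : Continuous F) :
    ∫ x, F x ∂cantorDistribution = 2⁻¹ * ∫ x, F (T 0 x) ∂cantorDistribution +
      2⁻¹ * ∫ x, F (T 1 x) ∂cantorDistribution := by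
  have hi : ∀ i, Integrable F (cantorDistribution.map (T i)) := fun i =>
    (integrable_map_measure hF.aestronglyMeasurable (continuous_T i).aemeasurable).2
      (integrable_cantorDistribution (hF.comp (continuous_T i)))
  conv_lhs => rw [isCantorDistribution_cantorDistribution.2]
  rw [integral_add_measure ((hi 0).smul_measure (by simp)) ((hi 1).smul_measure (by simp)),
    integral_smul_measure, integral_smul_measure,
    integral_map (continuous_T 0).aemeasurable hF.aestronglyMeasurable,
    integral_map (continuous_T 1).aemeasurable hF.aestronglyMeasurable]
  simp

theorem integral_one_sub_cantorDistribution {F : ℝ → ℝ} (hF : Continuous F) :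
    ∫ x, F (1 - x) ∂cantorDistribution = ∫ x, F x ∂cantorDistribution := by
  conv_rhs => rw [← map_one_sub_cantorDistribution]
  rw [integral_map (by fun_prop) hF.aestronglyMeasurable]

theorem integral_quadratic_cantorDistribution_eq_moments (a b c : ℝ) :
    ∫ x, (a * x ^ 2 + b * x + c) ∂cantorDistribution =
      a * ∫ x, x ^ 2 ∂cantorDistribution + b * ∫ x, x ∂cantorDistribution + c := by
  have i1 := integrable_cantorDistribution (F := fun x => a * x ^ 2) (by fun_prop)
  have i2 := integrable_cantorDistribution (F := fun x => b * x) (by fun_prop)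
  have i3 := integrable_cantorDistribution (F := fun x => a * x ^ 2 + b * x) (by fun_prop)
  rw [integral_add i3 (integrable_const _), integral_add i1 i2, integral_const_mul,
    integral_const_mul]
  simp

theorem integral_id_cantorDistribution : ∫ x, x ∂cantorDistribution = 1 / 2 := by
  have h := integral_one_sub_cantorDistribution (F := fun x => x) continuous_id
  have h' := integral_quadratic_cantorDistribution_eq_moments 0 (-1) 1
  have e : ∀ x : ℝ, 0 * x ^ 2 + -1 * x + 1 = 1 - x := fun x => by ring
  simp only [e] at h'
  linarith

/-- Self-similarity gives a linear equation for the second moment, once the mean is known. -/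
theorem integral_sq_cantorDistribution : ∫ x, x ^ 2 ∂cantorDistribution = 3 / 8 := by
  have h := integral_cantorDistribution_eq (continuous_pow 2)
  have e0 : ∀ x : ℝ, T 0 x ^ 2 = 1 / 9 * x ^ 2 + 0 * x + 0 := fun x => by rw [T_zero]; ring
  have e1 : ∀ x : ℝ, T 1 x ^ 2 = 1 / 9 * x ^ 2 + 4 / 9 * x + 4 / 9 := fun x => by
    rw [T_one]; ring
  simp only [e0, e1] at h
  rw [integral_quadratic_cantorDistribution_eq_moments,
    integral_quadratic_cantorDistribution_eq_moments, integral_id_cantorDistribution] at h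
  linarith

theorem integral_quadratic_cantorDistribution (a b c : ℝ) :
    ∫ x, (a * x ^ 2 + b * x + c) ∂cantorDistribution = a * (3 / 8) + b / 2 + c := by
  rw [integral_quadratic_cantorDistribution_eq_moments, integral_id_cantorDistribution,
    integral_sq_cantorDistribution]
  ring

/-- All explicit estimates below use quadratic minorants, whose integrals are known from the first
two moments. -/
theorem le_integral_of_quadratic_le {F : ℝ → ℝ} (hF : Continuous F) (a b c : ℝ)
    (h : ∀ x, 0 ≤ x → x ≤ 1 → a * x ^ 2 + b * x + c ≤ F x) :
    a * (3 / 8) + b / 2 + c ≤ ∫ x, F x ∂cantorDistribution := by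
  rw [← integral_quadratic_cantorDistribution]
  exact integral_cantorDistribution_mono (by fun_prop) hF h

/-! ### The unconstrained distortion on the line -/

/-- The distortion `∫ min_{a ∈ α} (x - a)² dP(x)` of a finite set of reals. -/
noncomputable def lineDistortion (α : Finset ℝ) : ℝ :=
  ∫ x, Metric.infDist x (α : Set ℝ) ^ 2 ∂cantorDistribution

theorem infDist_sq_le {α : Finset ℝ} {a : ℝ} (ha : a ∈ α) (x : ℝ) :
    Metric.infDist x (α : Set ℝ) ^ 2 ≤ (x - a) ^ 2 := by
  rw [← sq_abs (x - a), ← Real.dist_eq]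
  exact pow_le_pow_left₀ Metric.infDist_nonneg (Metric.infDist_le_dist_of_mem (by simpa)) 2

theorem le_infDist_sq {α : Finset ℝ} (hα : α.Nonempty) {g x : ℝ}
    (h : ∀ a ∈ α, g ≤ (x - a) ^ 2) : g ≤ Metric.infDist x (α : Set ℝ) ^ 2 := by
  obtain ⟨a, ha, e⟩ := α.finite_toSet.isCompact.exists_infDist_eq_dist (by simpa) x
  rw [e, Real.dist_eq, sq_abs]
  exact h a (by simpa using ha)

theorem continuous_infDist_sq (α : Finset ℝ) :
    Continuous fun x => Metric.infDist x (α : Set ℝ) ^ 2 :=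
  (Metric.continuous_infDist_pt _).pow 2

theorem lineDistortion_le_of_dominated {α β : Finset ℝ} (hα : α.Nonempty)
    (h : ∀ x, 0 ≤ x → x ≤ 1 → ∀ a ∈ α, ∃ b ∈ β, (x - b) ^ 2 ≤ (x - a) ^ 2) :
    lineDistortion β ≤ lineDistortion α := by
  refine integral_cantorDistribution_mono (continuous_infDist_sq _) (continuous_infDist_sq _)
    fun x h0 h1 => le_infDist_sq hα fun a ha => ?_
  obtain ⟨b, hb, hab⟩ := h x h0 h1 a ha
  exact (infDist_sq_le hb x).trans hab

theorem le_lineDistortion_of_quadratic_le {α : Finset ℝ} (hα : α.Nonempty) (a b c : ℝ)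
    (h : ∀ x, 0 ≤ x → x ≤ 1 → ∀ y ∈ α, a * x ^ 2 + b * x + c ≤ (x - y) ^ 2) :
    a * (3 / 8) + b / 2 + c ≤ lineDistortion α :=
  le_integral_of_quadratic_le (continuous_infDist_sq _) a b c
    fun x h0 h1 => le_infDist_sq hα (h x h0 h1)

/-- The points of `α` as seen from the left half `J₁`, rescaled to `[0, 1]`. -/
noncomputable def zoomLeft (α : Finset ℝ) : Finset ℝ := α.image fun a => 3 * a

/-- The points of `α` as seen from the right half `J₂`, rescaled to `[0, 1]`. -/
noncomputable def zoomRight (α : Finset ℝ) : Finset ℝ := α.image fun a => 3 * a - 2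

theorem card_zoomLeft_le (α : Finset ℝ) : (zoomLeft α).card ≤ α.card := Finset.card_image_le

theorem card_zoomRight_le (α : Finset ℝ) : (zoomRight α).card ≤ α.card := Finset.card_image_le

/-- Each half has mass `1/2` and squared distances there shrink by `9`, whence the factor `18`. -/
theorem lineDistortion_self_similar {α : Finset ℝ} (hα : α.Nonempty) :
    18 * lineDistortion α = lineDistortion (zoomLeft α) + lineDistortion (zoomRight α) := by
  have h0 : ∀ x, Metric.infDist (T 0 x) (α : Set ℝ) ^ 2 =
      9⁻¹ * Metric.infDist x (zoomLeft α : Set ℝ) ^ 2 := by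
    intro x
    rw [T_zero]
    apply le_antisymm
    · have : 9 * Metric.infDist (x / 3) (α : Set ℝ) ^ 2 ≤
          Metric.infDist x (zoomLeft α : Set ℝ) ^ 2 := by
        refine le_infDist_sq (hα.image _) fun b hb => ?_
        obtain ⟨a, ha, rfl⟩ := Finset.mem_image.1 hb
        linarith [infDist_sq_le ha (x / 3)]
      linarith
    · refine le_infDist_sq hα fun a ha => ?_
      have := infDist_sq_le (Finset.mem_image_of_mem (fun a => 3 * a) ha) x
      unfold zoomLeft
      linarith
  have h1 : ∀ x, Metric.infDist (T 1 x) (α : Set ℝ) ^ 2 =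
      9⁻¹ * Metric.infDist x (zoomRight α : Set ℝ) ^ 2 := by
    intro x
    rw [T_one]
    apply le_antisymm
    · have : 9 * Metric.infDist (x / 3 + 2 / 3) (α : Set ℝ) ^ 2 ≤
          Metric.infDist x (zoomRight α : Set ℝ) ^ 2 := by
        refine le_infDist_sq (hα.image _) fun b hb => ?_
        obtain ⟨a, ha, rfl⟩ := Finset.mem_image.1 hb
        linarith [infDist_sq_le ha (x / 3 + 2 / 3)]
      linarith
    · refine le_infDist_sq hα fun a ha => ?_
      have := infDist_sq_le (Finset.mem_image_of_mem (fun a => 3 * a - 2) ha) x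
      unfold zoomRight
      linarith
  unfold lineDistortion
  rw [integral_cantorDistribution_eq (continuous_infDist_sq α)]
  simp only [h0, h1]
  rw [integral_const_mul, integral_const_mul]
  ring

theorem lineDistortion_image_one_sub {α : Finset ℝ} (hα : α.Nonempty) :
    lineDistortion (α.image fun a => 1 - a) = lineDistortion α := by
  unfold lineDistortion
  rw [← integral_one_sub_cantorDistribution (continuous_infDist_sq α)]
  congr 1
  funext x
  apply le_antisymm
  · refine le_infDist_sq hα fun a ha => ?_
    have := infDist_sq_le (Finset.mem_image_of_mem (fun a => 1 - a) ha) x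
    linarith
  · refine le_infDist_sq (hα.image _) fun b hb => ?_
    obtain ⟨a, ha, rfl⟩ := Finset.mem_image.1 hb
    linarith [infDist_sq_le ha (1 - x)]

/-! ### The lower bound -/

/-- The affine functions of the number of points whose supremum over `k` is the optimal
unconstrained distortion. -/
noncomputable def affineBound (k n : ℕ) : ℝ := (17 * 2 ^ k - 16 * n) / (8 * 18 ^ k)

theorem affineBound_succ_add (k p q : ℕ) :
    18 * affineBound (k + 1) (p + q) = affineBound k p + affineBound k q := by
  unfold affineBound
  push_cast
  field_simp
  ring

theorem affineBound_anti (k : ℕ) {m n : ℕ} (h : m ≤ n) : affineBound k n ≤ affineBound k m := by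
  unfold affineBound
  have : (m : ℝ) ≤ n := by exact_mod_cast h
  gcongr

/-- This fails for `k = 0` and `k = 1`, where the value is `1/8`; those two levels are the source of
the explicit small cases later. -/
theorem affineBound_one_le_of_two_le {k : ℕ} (hk : 2 ≤ k) : affineBound k 1 ≤ 1 / 16 := by
  unfold affineBound
  rw [div_le_div_iff₀ (by positivity) (by norm_num)]
  have h9 : (9 : ℝ) ^ 2 ≤ 9 ^ k := pow_le_pow_right₀ (by norm_num) hk
  have h2 : (1 : ℝ) ≤ 2 ^ k := one_le_pow₀ (by norm_num)
  have e : (18 : ℝ) ^ k = 9 ^ k * 2 ^ k := by rw [← mul_pow]; norm_num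
  rw [e]
  push_cast
  nlinarith

theorem affineBound_one_le (k : ℕ) : affineBound k 1 ≤ 1 / 8 := by
  rcases k with _ | _ | k
  · norm_num [affineBound]
  · norm_num [affineBound]
  · exact (affineBound_one_le_of_two_le (by omega)).trans (by norm_num)

theorem affineBound_two_le (k : ℕ) : affineBound k 2 ≤ 1 / 72 := by
  rcases k with _ | _ | _ | k
  · norm_num [affineBound]
  · norm_num [affineBound]
  · norm_num [affineBound]
  · unfold affineBound
    rw [div_le_div_iff₀ (by positivity) (by norm_num)]
    have h9 : (9 : ℝ) ^ 3 ≤ 9 ^ (k + 3) := pow_le_pow_right₀ (by norm_num) (by omega)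
    have h2 : (1 : ℝ) ≤ 2 ^ (k + 3) := one_le_pow₀ (by norm_num)
    have e : (18 : ℝ) ^ (k + 3) = 9 ^ (k + 3) * 2 ^ (k + 3) := by rw [← mul_pow]; norm_num
    rw [e]
    push_cast
    nlinarith

/-- Split two points as `1 + 1`; each half contributes at most `1/8`. -/
theorem affineBound_succ_le_of_two_le (k : ℕ) {n : ℕ} (hn : 2 ≤ n) :
    18 * affineBound (k + 1) n ≤ 1 / 4 := by
  have h := affineBound_succ_add k 1 1
  have := affineBound_one_le k
  have := affineBound_anti (k + 1) hn
  norm_num at h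
  linarith

theorem one_eighth_le_lineDistortion_of_card_eq_one {α : Finset ℝ} (h : α.card = 1) :
    1 / 8 ≤ lineDistortion α := by
  obtain ⟨a, rfl⟩ := Finset.card_eq_one.1 h
  have := le_lineDistortion_of_quadratic_le (Finset.singleton_nonempty a) 1 (-2 * a) (a ^ 2)
    (by intro x _ _ y hy; rw [Finset.mem_singleton.1 hy]; linarith)
  nlinarith [sq_nonneg (a - 1 / 2)]

theorem lineDistortion_nonneg (α : Finset ℝ) : 0 ≤ lineDistortion α :=
  integral_nonneg fun _ => sq_nonneg _

theorem lineDistortion_zoomLeft_le {α β : Finset ℝ} (hα : α.Nonempty)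
    (h : ∀ x, 0 ≤ x → x ≤ 1 / 3 → ∀ a ∈ α, ∃ b ∈ β, (x - b) ^ 2 ≤ (x - a) ^ 2) :
    lineDistortion (zoomLeft β) ≤ lineDistortion (zoomLeft α) := by
  refine lineDistortion_le_of_dominated (hα.image _) fun x h0 h1 a' ha' => ?_
  obtain ⟨a, ha, rfl⟩ := Finset.mem_image.1 ha'
  obtain ⟨b, hb, hab⟩ := h (x / 3) (by linarith) (by linarith) a ha
  exact ⟨_, Finset.mem_image_of_mem _ hb, by linarith⟩

theorem lineDistortion_zoomRight_le {α β : Finset ℝ} (hα : α.Nonempty)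
    (h : ∀ x, 2 / 3 ≤ x → x ≤ 1 → ∀ a ∈ α, ∃ b ∈ β, (x - b) ^ 2 ≤ (x - a) ^ 2) :
    lineDistortion (zoomRight β) ≤ lineDistortion (zoomRight α) := by
  refine lineDistortion_le_of_dominated (hα.image _) fun x h0 h1 a' ha' => ?_
  obtain ⟨a, ha, rfl⟩ := Finset.mem_image.1 ha'
  obtain ⟨b, hb, hab⟩ := h (x / 3 + 2 / 3) (by linarith) (by linarith) a ha
  exact ⟨_, Finset.mem_image_of_mem _ hb, by linarith⟩

/-- `affineBound k` bounds the distortion of all finite nonempty sets from below. -/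
def IsLowerBoundAt (k : ℕ) : Prop :=
  ∀ α : Finset ℝ, α.Nonempty → affineBound k α.card ≤ lineDistortion α

theorem IsLowerBoundAt.le_zoomLeft {k m : ℕ} (ih : IsLowerBoundAt k) {α β : Finset ℝ}
    (hα : α.Nonempty) (hβ : β.Nonempty) (hm : β.card ≤ m)
    (h : ∀ x, 0 ≤ x → x ≤ 1 / 3 → ∀ a ∈ α, ∃ b ∈ β, (x - b) ^ 2 ≤ (x - a) ^ 2) :
    affineBound k m ≤ lineDistortion (zoomLeft α) :=
  ((affineBound_anti k ((card_zoomLeft_le β).trans hm)).trans (ih _ (hβ.image _))).trans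
    (lineDistortion_zoomLeft_le hα h)

theorem IsLowerBoundAt.le_zoomRight {k m : ℕ} (ih : IsLowerBoundAt k) {α β : Finset ℝ}
    (hα : α.Nonempty) (hβ : β.Nonempty) (hm : β.card ≤ m)
    (h : ∀ x, 2 / 3 ≤ x → x ≤ 1 → ∀ a ∈ α, ∃ b ∈ β, (x - b) ^ 2 ≤ (x - a) ^ 2) :
    affineBound k m ≤ lineDistortion (zoomRight α) :=
  ((affineBound_anti k ((card_zoomRight_le β).trans hm)).trans (ih _ (hβ.image _))).trans
    (lineDistortion_zoomRight_le hα h)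

/-! ### Configurations that serve one half badly -/

/-- Seen from the right half, all points lie at or below `-1/2`, so that half alone contributes at
least `∫ (x + 1/2)² = 9/8`, far above `1/4`. -/
theorem affineBound_le_of_forall_le_half (k : ℕ) {α : Finset ℝ} (hα : 2 ≤ α.card)
    (h : ∀ a ∈ α, a ≤ 1 / 2) : affineBound (k + 1) α.card ≤ lineDistortion α := by
  have hne : α.Nonempty := Finset.card_pos.1 (by omega)
  have h1 := affineBound_succ_le_of_two_le k hα
  have h2 := lineDistortion_self_similar hne
  have h3 := lineDistortion_nonneg (zoomLeft α)
  have h4 := le_lineDistortion_of_quadratic_le (α := zoomRight α) (hne.image _) 1 1 (1 / 4) (by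
    intro x h0 _ y hy
    obtain ⟨a, ha, rfl⟩ := Finset.mem_image.1 hy
    nlinarith [h a ha])
  linarith

theorem affineBound_le_of_forall_half_le (k : ℕ) {α : Finset ℝ} (hα : 2 ≤ α.card)
    (h : ∀ a ∈ α, 1 / 2 ≤ a) : affineBound (k + 1) α.card ≤ lineDistortion α := by
  have hne : α.Nonempty := Finset.card_pos.1 (by omega)
  have hc : (α.image fun a => 1 - a).card = α.card :=
    Finset.card_image_of_injective _ fun a b hab => by simpa using hab
  rw [← lineDistortion_image_one_sub hne, ← hc]
  refine affineBound_le_of_forall_le_half k (by omega) fun b hb => ?_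
  obtain ⟨a, ha, rfl⟩ := Finset.mem_image.1 hb
  linarith [h a ha]

/-- Integrals over the three cells `[0, 1/9]`, `[2/9, 1/3]` and `[2/3, 1]`. -/
theorem le_integral_of_quadratic_le_on_cells {F : ℝ → ℝ} (hF : Continuous F)
    (a b c a' b' c' a'' b'' c'' : ℝ)
    (h : ∀ x, 0 ≤ x → x ≤ 1 → a * x ^ 2 + b * x + c ≤ F (x / 9))
    (h' : ∀ x, 0 ≤ x → x ≤ 1 → a' * x ^ 2 + b' * x + c' ≤ F (x / 9 + 2 / 9))
    (h'' : ∀ x, 0 ≤ x → x ≤ 1 → a'' * x ^ 2 + b'' * x + c'' ≤ F (x / 3 + 2 / 3)) :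
    (a * (3 / 8) + b / 2 + c) / 4 + (a' * (3 / 8) + b' / 2 + c') / 4 +
      (a'' * (3 / 8) + b'' / 2 + c'') / 2 ≤ ∫ x, F x ∂cantorDistribution := by
  rw [integral_cantorDistribution_eq hF,
    integral_cantorDistribution_eq (F := fun x => F (T 0 x)) (hF.comp (continuous_T 0))]
  have e0 : ∀ x : ℝ, x / 3 / 3 = x / 9 := fun x => by ring
  have e1 : ∀ x : ℝ, (x / 3 + 2 / 3) / 3 = x / 9 + 2 / 9 := fun x => by ring
  simp only [T_zero, T_one, e0, e1]
  have i := le_integral_of_quadratic_le (F := fun x => F (x / 9)) (by fun_prop) a b c h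
  have i' := le_integral_of_quadratic_le (F := fun x => F (x / 9 + 2 / 9)) (by fun_prop) a' b' c' h'
  have i'' := le_integral_of_quadratic_le (F := fun x => F (x / 3 + 2 / 3)) (by fun_prop)
    a'' b'' c'' h''
  linarith

/-- A point `b > 1/2` together with points `≤ -1/2` is not much better than one point. -/
theorem le_lineDistortion_of_single_point {β : Finset ℝ} (hβ : β.Nonempty) {b : ℝ}
    (hb : 1 / 2 < b) (h : ∀ y ∈ β, y ≤ -1 / 2 ∨ y = b) : 17 / 144 ≤ lineDistortion β := by
  have hF := continuous_infDist_sq β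
  have key : ∀ x g : ℝ, 0 ≤ x → g ≤ (x + 1 / 2) ^ 2 → g ≤ (x - b) ^ 2 →
      g ≤ Metric.infDist x (β : Set ℝ) ^ 2 := by
    intro x g hx h1 h2
    refine le_infDist_sq hβ fun y hy => ?_
    rcases h y hy with hy | rfl
    · refine h1.trans ?_
      nlinarith
    · exact h2
  unfold lineDistortion
  -- The midpoint of `-1/2` and `b` is at most `1/9` exactly when `b ≤ 13/18`. Then, on the first
  -- cell, the minimum of the two squared distances minus `x² / 81` is concave, and the minorant is
  -- its chord: `-1/2` is nearer at the left end, `b` at the right end.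
  rcases le_or_gt b (13 / 18) with hb1 | hb1
  · refine le_trans ?_ (le_integral_of_quadratic_le_on_cells hF
      (1 / 81) (-2 / 9 * b + (b + 1 / 2) * (b - 1 / 2)) (b ^ 2 - (b + 1 / 2) * (b - 1 / 2))
      (1 / 81) (2 / 9 * (2 / 9 - b)) ((2 / 9 - b) ^ 2)
      (1 / 9) (2 / 3 * (2 / 3 - b)) ((2 / 3 - b) ^ 2) ?_ ?_ ?_)
    · nlinarith
    · intro x h0 h1
      have hG : 0 ≤ (1 - x) * ((b + 1 / 2) * (b - 1 / 2)) :=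
        mul_nonneg (by linarith) (mul_nonneg (by linarith) (by linarith))
      have hG' : 0 ≤ x * ((b + 1 / 2) * (13 / 18 - b)) :=
        mul_nonneg h0 (mul_nonneg (by linarith) (by linarith))
      apply key _ _ (by linarith) <;> nlinarith
    · intro x h0 h1
      apply key _ _ (by linarith) <;> nlinarith
    · intro x h0 h1
      apply key _ _ (by linarith) <;> nlinarith
  -- Up to `17/18` the point `b` serves the whole second cell, and `-1/2` now serves the first. The
  -- resulting quadratic in `b` is minimal at `35/54`.
  rcases le_or_gt b (17 / 18) with hb2 | hb2
  · refine le_trans ?_ (le_integral_of_quadratic_le_on_cells hF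
      (1 / 81) (1 / 9) (1 / 4)
      (1 / 81) (2 / 9 * (2 / 9 - b)) ((2 / 9 - b) ^ 2)
      (1 / 9) (2 / 3 * (2 / 3 - b)) ((2 / 3 - b) ^ 2) ?_ ?_ ?_)
    · nlinarith [sq_nonneg (b - 35 / 54)]
    · intro x h0 h1
      apply key _ _ (by linarith) <;> nlinarith
    · intro x h0 h1
      apply key _ _ (by linarith) <;> nlinarith
    · intro x h0 h1
      apply key _ _ (by linarith) <;> nlinarith
  -- Here constants suffice: the first cell is at distance at least `1/2` and the second at least
  -- `17/18 - 1/3 = 11/18` from every point.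
  · refine le_trans ?_ (le_integral_of_quadratic_le_on_cells hF
      0 0 (1 / 4) 0 0 (121 / 324) 0 0 0 ?_ ?_ ?_)
    · norm_num
    · intro x h0 h1
      apply key _ _ (by linarith) <;> nlinarith
    · intro x h0 h1
      apply key _ _ (by linarith) <;> nlinarith
    · intro x h0 h1
      apply key _ _ (by linarith) <;> nlinarith [sq_nonneg (x / 3 + 2 / 3 - b)]

/-- One point cannot serve both halves: some half, once rescaled, has no point in `(-1, 1)`. It
contributes at least `∫ (x - 1)² = 3/8`, and `3/8 / 18 = 1/48`. -/
theorem le_lineDistortion_of_gap {β : Finset ℝ} (hβ : β.Nonempty) {a : ℝ}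
    (h : ∀ y ∈ β, 1 ≤ y ∨ y = a) : 1 / 48 ≤ lineDistortion β := by
  have hs := lineDistortion_self_similar hβ
  have h0 := lineDistortion_nonneg (zoomLeft β)
  have h1 := lineDistortion_nonneg (zoomRight β)
  rcases le_or_gt a (1 / 3) with ha | ha
  · have := le_lineDistortion_of_quadratic_le (α := zoomRight β) (hβ.image _) 1 (-2) 1 (by
      intro x h0 h1 y hy
      obtain ⟨z, hz, rfl⟩ := Finset.mem_image.1 hy
      rcases h z hz with hz | rfl <;> nlinarith)
    linarith
  · have := le_lineDistortion_of_quadratic_le (α := zoomLeft β) (hβ.image _) 1 (-2) 1 (by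
      intro x h0 h1 y hy
      obtain ⟨z, hz, rfl⟩ := Finset.mem_image.1 hy
      rcases h z hz with hz | rfl <;> nlinarith)
    linarith

/-! ### The induction step -/

theorem affineBound_le_of_one_middle {k : ℕ} (ih : IsLowerBoundAt k) {α : Finset ℝ} {c : ℝ}
    (hα : 2 ≤ α.card) (hc : c ∈ α) (hc1 : 1 / 3 < c) (hc2 : c ≤ 1 / 2)
    (h : ∀ a ∈ α, a ≤ 1 / 3 ∨ a = c ∨ 2 / 3 ≤ a) :
    affineBound (k + 1) α.card ≤ lineDistortion α := by
  have hne : α.Nonempty := ⟨c, hc⟩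
  have hs := lineDistortion_self_similar hne
  by_cases hle : ∀ a ∈ α, a ≤ 1 / 2
  · exact affineBound_le_of_forall_le_half k hα hle
  push Not at hle
  obtain ⟨b₀, hb₀, hb₀'⟩ := hle
  set A := α.filter (· ≤ 1 / 3) with hA
  set B := α.filter (2 / 3 ≤ ·) with hB
  have hb₀B : b₀ ∈ B := by
    refine Finset.mem_filter.2 ⟨hb₀, ?_⟩
    rcases h b₀ hb₀ with h | h | h <;> linarith
  have hcA : c ∉ A := fun hcA => by linarith [(Finset.mem_filter.1 hcA).2]
  have hcB : c ∉ B := fun hcB => by linarith [(Finset.mem_filter.1 hcB).2]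
  have hAB : Disjoint (insert c A) B := by
    rw [Finset.disjoint_left]
    intro x hx hx'
    have := (Finset.mem_filter.1 hx').2
    rcases Finset.mem_insert.1 hx with rfl | hx
    · linarith
    · linarith [(Finset.mem_filter.1 hx).2]
  have hunion : α = insert c A ∪ B := by
    ext x
    simp only [Finset.mem_union, Finset.mem_insert, hA, hB, Finset.mem_filter]
    constructor
    · intro hx
      rcases h x hx with h | h | h <;> tauto
    · rintro ((rfl | h) | h)
      exacts [hc, h.1, h.1]
  have hcard : α.card = A.card + 1 + B.card := by
    conv_lhs => rw [hunion]
    rw [Finset.card_union_of_disjoint hAB, Finset.card_insert_of_notMem hcA]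
  have hBpos : 1 ≤ B.card := Finset.card_pos.2 ⟨_, hb₀B⟩
  have hsum := affineBound_succ_add k (A.card + 1) B.card
  rw [← hcard] at hsum
  have hleft : affineBound k (A.card + 1) ≤ lineDistortion (zoomLeft α) := by
    refine ih.le_zoomLeft (β := insert c A) hne ⟨c, by simp⟩ (Finset.card_insert_le _ _)
      fun x h0 h1 a ha => ?_
    rcases h a ha with h | h | h
    · exact ⟨a, Finset.mem_insert_of_mem (Finset.mem_filter.2 ⟨ha, h⟩), le_rfl⟩
    · exact ⟨c, by simp, by rw [h]⟩
    · exact ⟨c, by simp, by nlinarith⟩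
  -- The midpoint of `c ≤ 1/2` and `b ≤ 5/6` is at most `2/3`, so such a `b` makes `c` useless for
  -- the right half, and `c` can be charged to the left alone.
  by_cases hb : ∃ b ∈ B, b ≤ 5 / 6
  · obtain ⟨b, hb, hb'⟩ := hb
    have hb2 := (Finset.mem_filter.1 hb).2
    have hright : affineBound k B.card ≤ lineDistortion (zoomRight α) := by
      refine ih.le_zoomRight (β := B) hne ⟨b, hb⟩ le_rfl fun x h0 h1 a ha => ?_
      rcases h a ha with h | h | h
      · exact ⟨b, hb, by nlinarith⟩
      · exact ⟨b, hb, by subst h; nlinarith⟩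
      · exact ⟨a, Finset.mem_filter.2 ⟨ha, h⟩, le_rfl⟩
    linarith
  push Not at hb
  have hfar : ∀ a ∈ α, a ≤ 1 / 2 ∨ 5 / 6 < a := by
    intro a ha
    rcases h a ha with h | h | h
    · left; linarith
    · left; linarith
    · exact Or.inr (hb a (Finset.mem_filter.2 ⟨ha, h⟩))
  -- Otherwise the cell `[2/3, 7/9]` is badly served: rescaled to `[0, 1]`, it sees no point in
  -- `(-3/2, 3/2]`, and `∫ (x - 3/2)² / 18 = 1/16`.
  have hright : 1 / 16 ≤ lineDistortion (zoomRight α) := by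
    have := lineDistortion_self_similar (α := zoomRight α) (hne.image _)
    have := lineDistortion_nonneg (zoomRight (zoomRight α))
    have := le_lineDistortion_of_quadratic_le (α := zoomLeft (zoomRight α))
      ((hne.image _).image _) 1 (-3) (9 / 4) (by
        intro x h0 h1 y hy
        obtain ⟨z, hz, rfl⟩ := Finset.mem_image.1 hy
        obtain ⟨a, ha, rfl⟩ := Finset.mem_image.1 hz
        rcases hfar a ha with h | h <;> nlinarith)
    linarith
  rcases Nat.lt_or_ge 1 B.card with hB2 | hB1
  · have := affineBound_anti k hB2
    have := affineBound_two_le k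
    linarith
  have hB1 : B.card = 1 := le_antisymm hB1 hBpos
  rw [hB1] at hsum hcard
  rcases Nat.lt_or_ge 1 k with hk | hk
  · have := affineBound_one_le_of_two_le hk
    linarith
  obtain ⟨b, hBb⟩ := Finset.card_eq_one.1 hB1
  have hbB : 5 / 6 < b := hb b (by rw [hBb]; simp)
  have hB' : ∀ a ∈ α, 2 / 3 ≤ a → a = b := by
    intro a ha h
    have : a ∈ B := Finset.mem_filter.2 ⟨ha, h⟩
    rwa [hBb, Finset.mem_singleton] at this
  rcases Nat.eq_zero_or_pos A.card with hA0 | hApos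
  · have h1 := affineBound_succ_le_of_two_le k hα
    have hAe : A = ∅ := Finset.card_eq_zero.1 hA0
    have := le_lineDistortion_of_quadratic_le (α := zoomLeft α) (hne.image _) 1 (-2) 1 (by
      intro x h0 h1 y hy
      obtain ⟨a, ha, rfl⟩ := Finset.mem_image.1 hy
      have : 1 / 3 < a := by
        by_contra hcon
        have : a ∈ A := Finset.mem_filter.2 ⟨ha, not_lt.1 hcon⟩
        simp [hAe] at this
      nlinarith)
    linarith
  rcases Nat.lt_or_ge 1 A.card with hA2 | hA1
  -- At least four points, and `k ≤ 1`: the `1/16` from the right half is already enough.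
  · have h4 : affineBound (k + 1) α.card ≤ affineBound (k + 1) 4 := affineBound_anti _ (by omega)
    have hl := lineDistortion_nonneg (zoomLeft α)
    interval_cases k <;> norm_num [affineBound] at h4 ⊢ <;> linarith
  have hA1 : A.card = 1 := by omega
  obtain ⟨a₀, hAa⟩ := Finset.card_eq_one.1 hA1
  have hA' : ∀ a ∈ α, a ≤ 1 / 3 → a = a₀ := by
    intro a ha h
    have : a ∈ A := Finset.mem_filter.2 ⟨ha, h⟩
    rwa [hAa, Finset.mem_singleton] at this
  have hl := le_lineDistortion_of_gap (β := zoomLeft α) (hne.image _) (a := 3 * a₀) (by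
    intro y hy
    obtain ⟨a, ha, rfl⟩ := Finset.mem_image.1 hy
    rcases le_or_gt a (1 / 3) with h | h
    · right; rw [hA' a ha h]
    · left; linarith)
  have hr := le_lineDistortion_of_single_point (β := zoomRight α) (hne.image _) (b := 3 * b - 2)
    (by linarith) (by
    intro y hy
    obtain ⟨a, ha, rfl⟩ := Finset.mem_image.1 hy
    rcases le_or_gt (2 / 3) a with h' | h'
    · right; rw [hB' a ha h']
    · left; rcases h a ha with h | h | h <;> linarith)
  have h3 : affineBound (k + 1) α.card = affineBound (k + 1) 3 := by rw [hcard, hA1]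
  rw [h3]
  -- For `k = 1` there is no slack: `1/48 + 17/144 = 20/144 = 18 * affineBound 2 3`.
  interval_cases k <;> norm_num [affineBound] <;> linarith

theorem IsLowerBoundAt.succ {k : ℕ} (ih : IsLowerBoundAt k) : IsLowerBoundAt (k + 1) := by
  intro α hne
  rcases Nat.lt_or_ge 1 α.card with hα | h1
  swap
  · have h1 : α.card = 1 := le_antisymm h1 (Finset.card_pos.2 hne)
    rw [h1]
    exact (affineBound_one_le _).trans (one_eighth_le_lineDistortion_of_card_eq_one h1)
  by_cases hle : ∀ a ∈ α, a ≤ 1 / 2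
  · exact affineBound_le_of_forall_le_half k hα hle
  by_cases hge : ∀ a ∈ α, 1 / 2 ≤ a
  · exact affineBound_le_of_forall_half_le k hα hge
  by_cases hone : ∃ c ∈ α, 1 / 3 < c ∧ c < 2 / 3 ∧ ∀ a ∈ α, a ≤ 1 / 3 ∨ a = c ∨ 2 / 3 ≤ a
  · obtain ⟨c, hc, hc1, hc2, h⟩ := hone
    rcases le_or_gt c (1 / 2) with hc' | hc'
    · exact affineBound_le_of_one_middle ih hα hc hc1 hc' h
    · have hcard : (α.image fun a => 1 - a).card = α.card :=
        Finset.card_image_of_injective _ fun a b hab => by simpa using hab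
      rw [← lineDistortion_image_one_sub hne, ← hcard]
      refine affineBound_le_of_one_middle ih (c := 1 - c) (by omega)
        (Finset.mem_image_of_mem _ hc) (by linarith) (by linarith) fun b hb => ?_
      obtain ⟨a, ha, rfl⟩ := Finset.mem_image.1 hb
      rcases h a ha with h | h | h
      · right; right; linarith
      · right; left; rw [h]
      · left; linarith
  have hs := lineDistortion_self_similar hne
  set A := α.filter (· ≤ 1 / 3) with hA
  set B := α.filter (2 / 3 ≤ ·) with hB
  set C := α.filter (fun a => 1 / 3 < a ∧ a < 2 / 3) with hC
  have hunion : α = A ∪ B ∪ C := by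
    ext x
    simp only [Finset.mem_union, hA, hB, hC, Finset.mem_filter]
    constructor
    · intro hx
      rcases le_or_gt x (1 / 3) with h | h
      · tauto
      · rcases le_or_gt (2 / 3) x with h' | h' <;> tauto
    · tauto
  have hAB : Disjoint A B := by
    rw [Finset.disjoint_left]
    intro x hx hx'
    linarith [(Finset.mem_filter.1 hx).2, (Finset.mem_filter.1 hx').2]
  have hABC : Disjoint (A ∪ B) C := by
    rw [Finset.disjoint_left]
    intro x hx hx'
    have h' := (Finset.mem_filter.1 hx').2
    rcases Finset.mem_union.1 hx with hx | hx <;>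
      linarith [(Finset.mem_filter.1 hx).2, h'.1, h'.2]
  have hcard : α.card = A.card + B.card + C.card := by
    conv_lhs => rw [hunion]
    rw [Finset.card_union_of_disjoint hABC, Finset.card_union_of_disjoint hAB]
  push Not at hle hge
  obtain ⟨b₀, hb₀, hb₀'⟩ := hle
  obtain ⟨a₀, ha₀, ha₀'⟩ := hge
  have hClass : ∀ a ∈ α, a ∈ A ∨ a ∈ C ∨ a ∈ B := by
    intro a ha
    rw [hunion, Finset.mem_union, Finset.mem_union] at ha
    tauto
  rcases C.eq_empty_or_nonempty with hC0 | ⟨c, hcC⟩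
  · have hClass' : ∀ a ∈ α, a ∈ A ∨ a ∈ B := by
      intro a ha
      simpa [hC0] using hClass a ha
    have ha₀A : a₀ ∈ A := (hClass' a₀ ha₀).resolve_right fun h => by
      linarith [(Finset.mem_filter.1 h).2]
    have hb₀B : b₀ ∈ B := (hClass' b₀ hb₀).resolve_left fun h => by
      linarith [(Finset.mem_filter.1 h).2]
    have ha₀1 := (Finset.mem_filter.1 ha₀A).2
    have hb₀1 := (Finset.mem_filter.1 hb₀B).2
    have hleft : affineBound k A.card ≤ lineDistortion (zoomLeft α) := by
      -- Clamping negative points to `0` makes every retained point at least as near to `[0, 1/3]`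
      -- as any point of `B`, without raising the count.
      refine ih.le_zoomLeft (β := A.image (max 0)) hne ⟨_, Finset.mem_image_of_mem _ ha₀A⟩
        Finset.card_image_le fun x h0 h1 a ha => ?_
      rcases hClass' a ha with h | h
      · refine ⟨_, Finset.mem_image_of_mem _ h, ?_⟩
        rcases max_cases 0 a with h | h <;> rw [h.1]
        nlinarith
      · have h' := (Finset.mem_filter.1 h).2
        refine ⟨_, Finset.mem_image_of_mem _ ha₀A, ?_⟩
        rcases max_cases 0 a₀ with h | h <;> rw [h.1] <;> nlinarith
    have hright : affineBound k B.card ≤ lineDistortion (zoomRight α) := by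
      refine ih.le_zoomRight (β := B.image (min 1)) hne ⟨_, Finset.mem_image_of_mem _ hb₀B⟩
        Finset.card_image_le fun x h0 h1 a ha => ?_
      rcases hClass' a ha with h | h
      · have h' := (Finset.mem_filter.1 h).2
        refine ⟨_, Finset.mem_image_of_mem _ hb₀B, ?_⟩
        rcases min_cases 1 b₀ with h | h <;> rw [h.1] <;> nlinarith
      · refine ⟨_, Finset.mem_image_of_mem _ h, ?_⟩
        rcases min_cases 1 a with h | h <;> rw [h.1]
        nlinarith
    have hsum := affineBound_succ_add k A.card B.card
    rw [hC0, Finset.card_empty, add_zero] at hcard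
    rw [← hcard] at hsum
    linarith
  -- Two or more middle points can be traded for the endpoints `1/3` and `2/3`, each at least as
  -- good for its own half as any middle point, so the total count does not grow.
  · have hC2 : 2 ≤ C.card := by
      by_contra hcon
      have hC1 : C.card = 1 := by
        have := Finset.card_pos.2 ⟨c, hcC⟩
        omega
      obtain ⟨c', hCc⟩ := Finset.card_eq_one.1 hC1
      have hcC' := Finset.mem_filter.1 hcC
      refine hone ⟨c, hcC'.1, hcC'.2.1, hcC'.2.2, fun a ha => ?_⟩
      rcases hClass a ha with h | h | h
      · exact Or.inl (Finset.mem_filter.1 h).2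
      · rw [hCc, Finset.mem_singleton] at h hcC
        exact Or.inr (Or.inl (h.trans hcC.symm))
      · exact Or.inr (Or.inr (Finset.mem_filter.1 h).2)
    have hleft : affineBound k (A.card + 1) ≤ lineDistortion (zoomLeft α) := by
      refine ih.le_zoomLeft (β := insert (1 / 3) A) hne ⟨_, Finset.mem_insert_self _ _⟩
        (Finset.card_insert_le _ _) fun x h0 h1 a ha => ?_
      rcases le_or_gt a (1 / 3) with h | h
      · exact ⟨a, Finset.mem_insert_of_mem (Finset.mem_filter.2 ⟨ha, h⟩), le_rfl⟩
      · exact ⟨_, Finset.mem_insert_self _ _, by nlinarith⟩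
    have hright : affineBound k (B.card + 1) ≤ lineDistortion (zoomRight α) := by
      refine ih.le_zoomRight (β := insert (2 / 3) B) hne ⟨_, Finset.mem_insert_self _ _⟩
        (Finset.card_insert_le _ _) fun x h0 h1 a ha => ?_
      rcases le_or_gt (2 / 3) a with h | h
      · exact ⟨a, Finset.mem_insert_of_mem (Finset.mem_filter.2 ⟨ha, h⟩), le_rfl⟩
      · exact ⟨_, Finset.mem_insert_self _ _, by nlinarith⟩
    have hsum := affineBound_succ_add k (A.card + 1) (B.card + 1)
    have := affineBound_anti (k + 1) (show A.card + 1 + (B.card + 1) ≤ α.card by omega)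
    linarith

theorem isLowerBoundAt (k : ℕ) : IsLowerBoundAt k := by
  induction k with
  | zero =>
    intro α hne
    rcases Nat.lt_or_ge 1 α.card with h | h
    · have h2 := affineBound_anti 0 h
      have : affineBound 0 2 ≤ 0 := by norm_num [affineBound]
      exact (h2.trans this).trans (lineDistortion_nonneg α)
    · have h1 : α.card = 1 := le_antisymm h (Finset.card_pos.2 hne)
      rw [h1]
      exact (affineBound_one_le _).trans (one_eighth_le_lineDistortion_of_card_eq_one h1)
  | succ k ih => exact ih.succ

/-! ### Words and the upper bound -/

theorem wordMap_eq (σ : List (Fin 2)) (x : ℝ) :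
    wordMap σ x = wordMap σ (1 / 2) + (x - 1 / 2) / 3 ^ σ.length := by
  induction σ with
  | nil => simp [wordMap]
  | cons i σ ih =>
    simp only [wordMap, Function.comp, List.length_cons, pow_succ]
    rw [ih]
    unfold T
    split_ifs
    · field_simp
    · field_simp
      ring

theorem continuous_wordMap (σ : List (Fin 2)) : Continuous (wordMap σ) := by
  have : wordMap σ = fun x => wordMap σ (1 / 2) + (x - 1 / 2) / 3 ^ σ.length :=
    funext (wordMap_eq σ)
  rw [this]
  fun_prop

theorem wordMap_append_singleton (σ : List (Fin 2)) (i : Fin 2) (x : ℝ) :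
    wordMap (σ ++ [i]) x = wordMap σ (T i x) := by
  induction σ with
  | nil => rfl
  | cons j σ ih => simp only [List.cons_append, wordMap, Function.comp, ih]

theorem T_injective (i : Fin 2) : Function.Injective (T i) := by
  intro x y h
  unfold T at h
  split_ifs at h <;> linarith

theorem T_mem_Icc (i : Fin 2) {x : ℝ} (hx : x ∈ Icc (0 : ℝ) 1) : T i x ∈ Icc (0 : ℝ) 1 := by
  obtain ⟨h0, h1⟩ := hx
  unfold T
  split_ifs <;> constructor <;> linarith

theorem T_ne_T {i j : Fin 2} (hij : i ≠ j) {x y : ℝ} (hx : x ∈ Icc (0 : ℝ) 1)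
    (hy : y ∈ Icc (0 : ℝ) 1) : T i x ≠ T j y := by
  obtain ⟨h0, h1⟩ := hx
  obtain ⟨h2, h3⟩ := hy
  fin_cases i <;> fin_cases j <;> simp [T] at hij ⊢ <;> intro h <;> linarith

theorem wordMap_mem_Icc (σ : List (Fin 2)) {x : ℝ} (hx : x ∈ Icc (0 : ℝ) 1) :
    wordMap σ x ∈ Icc (0 : ℝ) 1 := by
  induction σ with
  | nil => exact hx
  | cons i σ ih => exact T_mem_Icc i ih

theorem measurableSet_basicInterval (σ : List (Fin 2)) : MeasurableSet (basicInterval σ) :=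
  (isCompact_Icc.image (continuous_wordMap σ)).measurableSet

/-- Induction on the word: the other map sends `[0, 1]` off the cell, so only the branch of the
first letter carries mass there. -/
theorem restrict_basicInterval (σ : List (Fin 2)) :
    cantorDistribution.restrict (basicInterval σ) =
      (2⁻¹ : ℝ≥0∞) ^ σ.length • cantorDistribution.map (wordMap σ) := by
  induction σ with
  | nil =>
    have h : basicInterval [] = Icc 0 1 := by simp [basicInterval, wordMap]
    rw [h, Measure.restrict_eq_self_of_ae_mem ae_mem_Icc_cantorDistribution]
    simp [wordMap]
  | cons i σ ih =>
    ext s hs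
    have hpre : T i ⁻¹' (s ∩ basicInterval (i :: σ)) = T i ⁻¹' s ∩ basicInterval σ := by
      have : basicInterval (i :: σ) = T i '' basicInterval σ := by
        simp only [basicInterval, wordMap, image_comp]
      rw [preimage_inter, this, preimage_image_eq _ (T_injective i)]
    have hnull : ∀ j, j ≠ i → cantorDistribution (T j ⁻¹' (s ∩ basicInterval (i :: σ))) = 0 := by
      intro j hj
      refine measure_mono_null (fun x hx => ?_) (ae_iff.1 ae_mem_Icc_cantorDistribution)
      intro hx'
      obtain ⟨y, hy, hyx⟩ := hx.2
      exact T_ne_T hj hx' (wordMap_mem_Icc σ hy) hyx.symm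
    have hi : cantorDistribution (T i ⁻¹' s ∩ basicInterval σ) =
        (2⁻¹ : ℝ≥0∞) ^ σ.length * cantorDistribution (wordMap (i :: σ) ⁻¹' s) := by
      rw [← Measure.restrict_apply ((continuous_T i).measurable hs), ih, Measure.smul_apply,
        Measure.map_apply (continuous_wordMap σ).measurable ((continuous_T i).measurable hs)]
      rfl
    rw [Measure.restrict_apply hs, cantorDistribution_apply
      (hs.inter (measurableSet_basicInterval _)), Measure.smul_apply,
      Measure.map_apply (continuous_wordMap _).measurable hs, List.length_cons, pow_succ,
      smul_eq_mul, mul_comm (_ ^ _), mul_assoc, ← hi, ← hpre]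
    fin_cases i
    · have := hnull 1 (by decide)
      simp_all
    · have := hnull 0 (by decide)
      simp_all

theorem integral_wordMap (σ : List (Fin 2)) :
    ∫ x, wordMap σ x ∂cantorDistribution = wordMap σ (1 / 2) := by
  have h := integral_quadratic_cantorDistribution 0 (1 / 3 ^ σ.length)
    (wordMap σ (1 / 2) - 1 / 2 / 3 ^ σ.length)
  have e : ∀ x, 0 * x ^ 2 + 1 / 3 ^ σ.length * x +
      (wordMap σ (1 / 2) - 1 / 2 / 3 ^ σ.length) = wordMap σ x := fun x => by
    rw [wordMap_eq σ x]; ring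
  simp only [e] at h
  rw [h]
  ring

/-- `wordMap σ` is affine, hence carries the mean `1/2` of the whole distribution to the mean of the
cell. -/
theorem center_eq (σ : List (Fin 2)) : center σ = wordMap σ (1 / 2) := by
  have hP : cantorDistribution.real (basicInterval σ) = 2⁻¹ ^ σ.length := by
    have hm : IsProbabilityMeasure (cantorDistribution.map (wordMap σ)) :=
      Measure.isProbabilityMeasure_map (continuous_wordMap σ).aemeasurable
    rw [measureReal_def, ← Measure.restrict_apply_univ, restrict_basicInterval]
    simp
  unfold center
  rw [hP, restrict_basicInterval, integral_smul_measure,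
    integral_map (continuous_wordMap σ).aemeasurable (by fun_prop), integral_wordMap]
  simp

theorem center_mem_Icc (σ : List (Fin 2)) : center σ ∈ Icc (0 : ℝ) 1 := by
  rw [center_eq]
  exact wordMap_mem_Icc σ (by norm_num)

theorem integral_wordMap_sub_center_sq (σ : List (Fin 2)) (h : ℝ) :
    ∫ x, ρ (wordMap σ x) (center σ, h) ∂cantorDistribution = 1 / 9 ^ σ.length / 8 + h ^ 2 := by
  have e : ∀ x, ρ (wordMap σ x) (center σ, h) = 1 / 9 ^ σ.length * x ^ 2 +
      -1 / 9 ^ σ.length * x + (1 / 9 ^ σ.length / 4 + h ^ 2) := fun x => by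
    have h9 : (9 : ℝ) ^ σ.length = (3 ^ σ.length) ^ 2 := by
      rw [← pow_mul, mul_comm, pow_mul]
      norm_num
    rw [center_eq, ρ, wordMap_eq σ x, h9]
    field_simp
    ring
  simp only [e]
  rw [integral_quadratic_cantorDistribution]
  ring

theorem sum_vector_succ {l : ℕ} (G : List.Vector (Fin 2) (l + 1) → ℝ) :
    ∑ σ, G σ = ∑ τ : List.Vector (Fin 2) l, G (0 ::ᵥ τ) +
      ∑ τ : List.Vector (Fin 2) l, G (1 ::ᵥ τ) := by
  let e : Fin 2 × List.Vector (Fin 2) l ≃ List.Vector (Fin 2) (l + 1) :=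
    { toFun := fun p => p.1 ::ᵥ p.2
      invFun := fun v => (v.head, v.tail)
      left_inv := fun p => by simp
      right_inv := fun v => by simp }
  rw [← Fintype.sum_equiv e (fun p => G (p.1 ::ᵥ p.2)) G (fun _ => rfl),
    Fintype.sum_prod_type, Fin.sum_univ_two]

theorem integral_eq_sum_wordMap (l : ℕ) {F : ℝ → ℝ} (hF : Continuous F) :
    ∫ x, F x ∂cantorDistribution = (∑ σ : List.Vector (Fin 2) l,
      ∫ x, F (wordMap σ.toList x) ∂cantorDistribution) / 2 ^ l := by
  induction l generalizing F with
  | zero => simp [wordMap]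
  | succ l ih =>
    rw [sum_vector_succ, integral_cantorDistribution_eq hF,
      ih (F := fun x => F (T 0 x)) (hF.comp (continuous_T 0)),
      ih (F := fun x => F (T 1 x)) (hF.comp (continuous_T 1))]
    simp only [List.Vector.toList_cons, wordMap, Function.comp]
    ring

/-! ### The distortion of `α_n(I)` -/

theorem iInf_ρ_le {α : Finset (ℝ × ℝ)} {p : ℝ × ℝ} (hp : p ∈ α) (x : ℝ) :
    ⨅ a : α, ρ x a ≤ ρ x p :=
  ciInf_le (finite_range fun a : α => ρ x a).bddBelow ⟨p, hp⟩

theorem continuous_iInf_ρ {α : Finset (ℝ × ℝ)} (hα : α.Nonempty) :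
    Continuous fun x => ⨅ a : α, ρ x a := by
  have : Nonempty α := hα.to_subtype
  simp only [← Finset.inf'_univ_eq_ciInf]
  refine Continuous.finset_inf'_apply _ fun a _ => ?_
  unfold ρ
  fun_prop

theorem integral_iInf_wordMap_le {α : Finset (ℝ × ℝ)} {σ : List (Fin 2)} {h : ℝ}
    (hσ : (center σ, h) ∈ α) :
    ∫ x, ⨅ a : α, ρ (wordMap σ x) a ∂cantorDistribution ≤ 1 / 9 ^ σ.length / 8 + h ^ 2 := by
  rw [← integral_wordMap_sub_center_sq]
  have hw := continuous_wordMap σ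
  refine integral_cantorDistribution_mono ((continuous_iInf_ρ ⟨_, hσ⟩).comp hw) ?_
    fun x _ _ => iInf_ρ_le hσ _
  unfold ρ
  fun_prop

theorem distortion_alphaSet_le (n l : ℕ) (I : Finset (List.Vector (Fin 2) l))
    (hne : (alphaSet n l I).Nonempty) :
    distortion cantorDistribution (alphaSet n l I) ≤
      1 / 18 ^ l * (1 / 8) * ((2 ^ l - (I.card : ℝ)) + 1 / 9 * (I.card : ℝ)) + 1 / (n : ℝ) ^ 2 := by
  classical
  have hF := continuous_iInf_ρ hne
  -- Splitting a cell divides its variance by `9`: from `1/8` to `1/72` in units of `1 / 9 ^ l`, a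
  -- gain of `1/9`.
  have hbound : ∀ σ : List.Vector (Fin 2) l,
      ∫ x, ⨅ a : alphaSet n l I, ρ (wordMap σ.toList x) a ∂cantorDistribution ≤
        (1 / 9 ^ l / 8 + 1 / (n : ℝ) ^ 2) - if σ ∈ I then 1 / 9 ^ l / 9 else 0 := by
    intro σ
    split_ifs with hσ
    · have h0 := integral_iInf_wordMap_le (α := alphaSet n l I) (σ := σ.toList ++ [0])
        (h := 1 / (n : ℝ)) (by
          unfold alphaSet
          exact Finset.mem_union_left _ (Finset.mem_union_right _ (Finset.mem_image_of_mem _ hσ)))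
      have h1 := integral_iInf_wordMap_le (α := alphaSet n l I) (σ := σ.toList ++ [1])
        (h := 1 / (n : ℝ)) (by
          unfold alphaSet
          exact Finset.mem_union_right _ (Finset.mem_image_of_mem _ hσ))
      rw [integral_cantorDistribution_eq
        (F := fun x => ⨅ a : alphaSet n l I, ρ (wordMap σ.toList x) a)
        (hF.comp (continuous_wordMap _))]
      simp only [wordMap_append_singleton, List.length_append, List.Vector.toList_length,
        List.length_singleton, pow_succ] at h0 h1
      have e : (1 : ℝ) / (9 ^ l * 9) / 8 = 1 / 9 ^ l / 72 := by field_simp; norm_num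
      rw [e] at h0 h1
      simp only [pow_zero, one_mul] at h0 h1
      ring_nf at h0 h1 ⊢
      linarith
    · have h0 := integral_iInf_wordMap_le (α := alphaSet n l I) (σ := σ.toList)
        (h := 1 / (n : ℝ)) (by
          unfold alphaSet
          refine Finset.mem_union_left _ (Finset.mem_union_left _
            (Finset.mem_image_of_mem (fun σ : List.Vector (Fin 2) l => _) ?_))
          simpa using hσ)
      simpa using h0
  unfold distortion
  rw [integral_eq_sum_wordMap l hF, div_le_iff₀ (by positivity)]
  refine (Finset.sum_le_sum fun σ _ => hbound σ).trans_eq ?_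
  rw [Finset.sum_sub_distrib, Finset.sum_ite_mem, Finset.univ_inter, Finset.sum_const,
    Finset.sum_const, Finset.card_univ, card_vector, Fintype.card_fin]
  have e : (18 : ℝ) ^ l = 9 ^ l * 2 ^ l := by rw [← mul_pow]; norm_num
  rw [e, nsmul_eq_mul, nsmul_eq_mul]
  push_cast
  field_simp
  ring

theorem isAdmissible_alphaSet {n l : ℕ} (hn : 1 ≤ n) (I : Finset (List.Vector (Fin 2) l))
    (hI : I.card + 2 ^ l = n) :
    (alphaSet n l I : Set (ℝ × ℝ)) ⊆ segment n ∧ IsAdmissible segment n (alphaSet n l I) := by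
  classical
  have hsub : (alphaSet n l I : Set (ℝ × ℝ)) ⊆ segment n := by
    intro p hp
    have hp : p ∈ alphaSet n l I := hp
    unfold alphaSet at hp
    simp only [Finset.mem_union, Finset.mem_image] at hp
    rcases hp with (⟨σ, _, rfl⟩ | ⟨σ, _, rfl⟩) | ⟨σ, _, rfl⟩ <;> exact ⟨center_mem_Icc _, rfl⟩
  refine ⟨hsub, hsub.trans fun p hp => mem_biUnion (mem_Icc.2 ⟨hn, le_rfl⟩) hp, ?_, ?_⟩
  · rw [Nat.one_le_iff_ne_zero, Finset.card_ne_zero]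
    let σ : List.Vector (Fin 2) l := List.Vector.replicate l 0
    by_cases hσ : σ ∈ I
    · refine ⟨(center (σ.toList ++ [0]), 1 / (n : ℝ)), ?_⟩
      unfold alphaSet
      exact Finset.mem_union_left _ (Finset.mem_union_right _ (Finset.mem_image_of_mem _ hσ))
    · refine ⟨(center σ.toList, 1 / (n : ℝ)), ?_⟩
      unfold alphaSet
      refine Finset.mem_union_left _ (Finset.mem_union_left _
        (Finset.mem_image_of_mem (fun σ : List.Vector (Fin 2) l => _) ?_))
      simpa using hσ
  · unfold alphaSet
    refine (Finset.card_union_le _ _).trans ?_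
    refine (Nat.add_le_add ((Finset.card_union_le _ _).trans (Nat.add_le_add
      Finset.card_image_le Finset.card_image_le)) Finset.card_image_le).trans ?_
    have h := Finset.card_sdiff_add_card_eq_card (Finset.subset_univ I)
    rw [Finset.card_univ, card_vector, Fintype.card_fin] at h
    have h' : (Finset.univ \ I).card + I.card = 2 ^ l := by convert h
    omega

/-- Constrained distortions are bounded below by those on the line, raised by `1 / n²`. -/
theorem le_distortion_of_isAdmissible {n : ℕ} {α : Finset (ℝ × ℝ)}
    (hα : IsAdmissible segment n α) (k : ℕ) :
    affineBound k n + 1 / (n : ℝ) ^ 2 ≤ distortion cantorDistribution α := by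
  obtain ⟨hsub, h1, hcard⟩ := hα
  have hne : α.Nonempty := Finset.card_pos.1 h1
  have hne' : Nonempty α := hne.to_subtype
  have hlow := (affineBound_anti k (Finset.card_image_le.trans hcard)).trans
    (isLowerBoundAt k (α.image Prod.fst) (hne.image _))
  have hc := continuous_infDist_sq (α.image Prod.fst)
  have hmono := integral_cantorDistribution_mono (hc.add_const (1 / (n : ℝ) ^ 2))
    (continuous_iInf_ρ hne) fun x _ _ => by
      refine le_ciInf fun ⟨p, hp⟩ => ?_
      have hx := infDist_sq_le (Finset.mem_image_of_mem Prod.fst hp) x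
      obtain ⟨j, hj, -, hpj⟩ := mem_iUnion₂.1 (hsub hp)
      have hj0 : (0 : ℝ) < j := by exact_mod_cast hj.1
      have hjn : (j : ℝ) ≤ n := by exact_mod_cast hj.2
      -- The height is `1 / j` with `j ≤ n`; the lowest segment `S_n` is the best one.
      have hp2 : 1 / (n : ℝ) ^ 2 ≤ p.2 ^ 2 := by
        rw [hpj, div_pow, one_pow]
        gcongr
      exact add_le_add hx hp2
  rw [integral_add (integrable_cantorDistribution hc) (integrable_const _)] at hmono
  simp only [integral_const, probReal_univ, one_smul] at hmono
  exact (add_le_add_left hlow _).trans hmono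

end CantorQuantization

theorem theorem3p7 (n : ℕ) (hn : 2 ≤ n) (l : ℕ) (hl : 2 ^ l ≤ n) (hl' : n < 2 ^ (l + 1))
    (I : Finset (List.Vector (Fin 2) l)) (hI : I.card = n - 2 ^ l) :
    (CantorQuantization.alphaSet n l I : Set (ℝ × ℝ)) ⊆ CantorQuantization.segment n ∧
    CantorQuantization.IsOptimalSet CantorQuantization.segment
      CantorQuantization.cantorDistribution n (CantorQuantization.alphaSet n l I) ∧
    CantorQuantization.constrainedError CantorQuantization.segment
      CantorQuantization.cantorDistribution n =
        1 / 18 ^ l * (1 / 8) * ((2 ^ (l + 1) - (n : ℝ)) + 1 / 9 * ((n : ℝ) - 2 ^ l)) +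
          1 / (n : ℝ) ^ 2 := by
  open CantorQuantization in
  have hI' : I.card + 2 ^ l = n := by omega
  have hIr : (I.card : ℝ) = n - 2 ^ l := by
    rw [eq_sub_iff_add_eq]
    exact_mod_cast hI'
  obtain ⟨hsub, hadm⟩ := isAdmissible_alphaSet (by omega) I hI'
  set v : ℝ := 1 / 18 ^ l * (1 / 8) * ((2 ^ (l + 1) - (n : ℝ)) + 1 / 9 * ((n : ℝ) - 2 ^ l)) +
    1 / (n : ℝ) ^ 2 with hv
  -- The affine piece on `2 ^ l ≤ n ≤ 2 ^ (l + 1)` is the one of index `l + 1`.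
  have hbound : affineBound (l + 1) n + 1 / (n : ℝ) ^ 2 = v := by
    rw [hv, affineBound, pow_succ, pow_succ]
    congr 1
    field_simp
    ring
  have hlow : ∀ α, IsAdmissible segment n α → v ≤ distortion cantorDistribution α := fun α hα =>
    hbound ▸ le_distortion_of_isAdmissible hα (l + 1)
  have heq : distortion cantorDistribution (alphaSet n l I) = v := by
    refine le_antisymm ?_ (hlow _ hadm)
    refine (distortion_alphaSet_le n l I (Finset.card_pos.1 hadm.2.1)).trans_eq ?_
    rw [hIr, hv, pow_succ]
    ring
  have hleast : IsLeast {w | ∃ α : Finset (ℝ × ℝ), IsAdmissible segment n α ∧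
      w = distortion cantorDistribution α} v :=
    ⟨⟨_, hadm, heq.symm⟩, by rintro w ⟨α, hα, rfl⟩; exact hlow α hα⟩
  have herr : constrainedError segment cantorDistribution n = v := hleast.csInf_eq
  exact ⟨hsub, ⟨hadm, heq.trans herr.symm⟩, herr⟩
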